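/- Let $n\ge 1$. Let $\mathcal C_n$ be the half-cylinder: an annulus with $n$ marked points on one boundary component and none on the other. The marked points of its universal cover $\overline{\mathcal C}_n$ are labelled in order by $\mathbb Z$, the deck transformations being $i\mapsto i+\ell n$, $\ell\in\mathbb Z$. An edge of $\overline{\mathcal C}_n$ is (the isotopy class of an arc joining) an unordered pair $[i,j]$ of distinct integers; its length is $|j-i|$. An edge of $\mathcal C_n$ is a class of such edges modulo deck transformations; let $\pi$ be the projection; lengths are defined on classes. The vertices of the $4n$-gon are labelled counterclockwise by $\mathbb Z/4n$, and its edges are the unordered pairs of distinct vertices (sides included). On $\overline{\mathcal C}_n$ or on the $4n$-gon, two edges intersect if they can be labelled $[a,b]$, $[c,d]$ with $a\prec c\prec b\prec d$ in the cyclic order of the vertices (on $\mathbb Z$, the cyclic order induced by the linear order). A $k$-crossing is a set of $k$ pairwise intersecting edges; a $k$-crossing on $\mathcal C_n$ is the image under $\pi$ of a $k$-crossing on $\overline{\mathcal C}_n$. A $2$-triangulation of the $4n$-gon is an inclusion-maximal set of edges containing no $3$-crossing. A $2$-triangulation on $\mathcal C_n$ is an inclusion-maximal set $T$ of edges of $\mathcal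 C_n$ such that $\pi^{-1}(T)$ contains no $3$-crossing. A set of edges of the $4n$-gon is $n$-periodic if it is invariant under the rotation by $\pi/2$, that is, $i\mapsto i+n$. For a set $E$ of edges of $\mathcal C_n$ put $$\phi(E)=\{[\,i \bmod 4n,\ j\bmod 4n\,] : [i,j]\in\pi^{-1}(E),\ i\not\equiv j \bmod 4n\}.$$ Theorem. (1) $\phi$ restricts to a bijection from the set of $2$-triangulations on $\mathcal C_n$ onto the set of $n$-periodic $2$-triangulations of the $4n$-gon. (2) $\phi$ restricts to a bijection from the sets of edges of $\mathcal C_n$ of length at most $2n$ onto the $n$-periodic sets of edges of the $4n$-gon. (3) $\phi$ preserves $3$-crossings in both directions: reduction modulo $4n$ sends every $3$-crossing on $\overline{\mathcal C}_n$ formed by edges of length at most $2n$ to a $3$-crossing of the $4n$-gon; a set $E$ of edges of $\mathcal C_n$ of length at most $2n$ is a $3$-crossing on $\mathcal C_n$ if and only if $\phi(E)$ consists of all copies, under rotations by multiples of $\pi/2$, of the edges of some $3$-crossing of the $4n$-gon; and for every set $E$ of edges of $\mathcal C_n$ of length at most $2n$, $\pi^{-1}(E)$ contains no $3$-crossing if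 and only if $\phi(E)$ contains no $3$-crossing. -/

import Mathlib

namespace HalfCylinder

/-- An edge on a vertex set `V`: an unordered pair of distinct vertices. -/
def Edge (V : Type) : Type := {e : Sym2 V // ¬ e.IsDiag}

/-- The edge `e + t`, obtained by adding `t` to both end points of `e`. -/
def Edge.translate {V : Type} [AddGroup V] (e : Edge V) (t : V) : Edge V :=
  ⟨e.1.map (· + t), fun h => e.2 ((Sym2.isDiag_map (add_left_injective t)).1 h)⟩

/-- Two edges on a circularly ordered vertex set intersect if, for some labelling `[a, b]`, `[c, d]`
of their end points, `a ≺ c ≺ b ≺ d` in the cyclic order. -/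
def Edge.Crosses {V : Type} [CircularOrder V] (e f : Edge V) : Prop :=
  ∃ a b c d : V, e.1 = s(a, b) ∧ f.1 = s(c, d) ∧ sbtw a c b ∧ sbtw b d a

/-- A `k`-crossing: a set of `k` pairwise intersecting edges. -/
def IsCrossing {V : Type} [CircularOrder V] (k : ℕ) (C : Set (Edge V)) : Prop :=
  C.encard = k ∧ C.Pairwise Edge.Crosses

/-- A set of edges that contains no `k`-crossing. -/
def CrossingFree {V : Type} [CircularOrder V] (k : ℕ) (S : Set (Edge V)) : Prop :=
  ∀ C ⊆ S, ¬ IsCrossing k C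

/-- A `k`-triangulation of the convex `N`-gon, whose vertices are labelled counterclockwise by
`ZMod N`: a maximal set of edges without `(k + 1)`-crossings. -/
def IsPolygonTriangulation (N k : ℕ) (T : Set (Edge (ZMod N))) : Prop :=
  Maximal (CrossingFree (k + 1)) T

/-- Invariance of a set of edges of the `N`-gon under the rotation that sends each vertex `i` to
`i + n`. For `N = 4 * n` this is the rotation by `π / 2`. -/
def IsPeriodic (N n : ℕ) (S : Set (Edge (ZMod N))) : Prop :=
  ∀ e, e ∈ S ↔ e.translate (n : ZMod N) ∈ S

/-- All rotational copies of the edges in `S` by multiples of `n` vertices. -/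
def rotationOrbit (N n : ℕ) (S : Set (Edge (ZMod N))) : Set (Edge (ZMod N)) :=
  {e | ∃ f ∈ S, ∃ l : ℕ, e = f.translate ((l * n : ℕ) : ZMod N)}

/-- The length `|j - i|` of the edge `[i, j]` on the universal cover of the half-cylinder, whose
vertices are labelled by `ℤ`. -/
def Edge.length (e : Edge ℤ) : ℕ :=
  Sym2.lift ⟨fun i j : ℤ => (j - i).natAbs, fun i j => by dsimp only; omega⟩ e.1

/-- Two edges on the universal cover are translations of each other if they differ by a deck
transformation, that is, by the translation by a multiple of `n`. -/
def deckSetoid (n : ℕ) : Setoid (Edge ℤ) where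
  r e f := ∃ l : ℤ, f = e.translate (l * n)
  iseqv :=
    { refl := fun e => ⟨0, by
        apply Subtype.ext
        simp [Edge.translate]⟩
      symm := by
        rintro e f ⟨l, rfl⟩
        refine ⟨-l, ?_⟩
        apply Subtype.ext
        simp [Edge.translate, Sym2.map_map]
      trans := by
        rintro e f g ⟨l, rfl⟩ ⟨m, rfl⟩
        refine ⟨l + m, ?_⟩
        apply Subtype.ext
        simp [Edge.translate, Sym2.map_map, add_mul, add_assoc] }

/-- The edges of the half-cylinder `C_n` with `n` marked points on one boundary component: the
edges of its universal cover up to deck transformations. -/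
def CylinderEdge (n : ℕ) : Type := Quotient (deckSetoid n)

/-- The covering map on edges. -/
def proj (n : ℕ) (e : Edge ℤ) : CylinderEdge n := Quotient.mk (deckSetoid n) e

/-- The lift of a set of edges of `C_n` to the universal cover. -/
def lift (n : ℕ) (E : Set (CylinderEdge n)) : Set (Edge ℤ) := proj n ⁻¹' E

/-- A `k`-crossing on `C_n`: the projection of a `k`-crossing on the universal cover. -/
def IsCylinderCrossing (n k : ℕ) (E : Set (CylinderEdge n)) : Prop :=
  ∃ C : Set (Edge ℤ), IsCrossing k C ∧ proj n '' C = E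

/-- A `k`-triangulation on `C_n`: a maximal set of edges whose lift has no `(k + 1)`-crossing. -/
def IsCylinderTriangulation (n k : ℕ) (T : Set (CylinderEdge n)) : Prop :=
  Maximal (fun E => CrossingFree (k + 1) (lift n E)) T

/-- Every edge in `E` has length at most `L`. -/
def LengthLE (n L : ℕ) (E : Set (CylinderEdge n)) : Prop :=
  ∀ e ∈ lift n E, e.length ≤ L

/-- The edges of the `N`-gon obtained by reducing edges of the universal cover modulo `N`. -/
def reduceMod (N : ℕ) (S : Set (Edge ℤ)) : Set (Edge (ZMod N)) :=
  {e | ∃ f ∈ S, e.1 = f.1.map (fun i : ℤ => (i : ZMod N))}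

/-- The canonical map `φ`: lift to the universal cover and reduce modulo `4 * n`. -/
def toPolygon (n : ℕ) (E : Set (CylinderEdge n)) : Set (Edge (ZMod (4 * n))) :=
  reduceMod (4 * n) (lift n E)

end HalfCylinder

namespace HalfCylinder

/-! Every edge of the `4n`-gon has a lift of length at most `2n`, unique up to translation by `4n`,
except that the two kinds of lift of a diameter differ by `2n`, which is still a deck
transformation. So φ is bijective on sets of short edges (`bijOn_toPolygon_lengthLE`). A 3-crossing
of short edges on ℤ spans less than `4n` and hence survives reduction; conversely a 3-crossing of
the polygon lifts to short edges, after a half turn of one edge if necessary (`exists_interleave`).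
An edge longer than `2n` forms a 3-crossing with two of its translates, so crossing-free sets on the
cylinder are automatically short.

The remaining point is that a cylinder triangulation, whose image is a priori maximal only among
periodic sets, has a maximal image (`blocked_of_orbitBlocked`). Let `[a, d]` be missing from it.
Adding the whole orbit of `[a, d]` creates a 3-crossing. If no two edges of the set that cross each
other both cross `[a, d]`, then some edge `[x, y]` of the set satisfies `a < x < a + n < d < y < d +
n`. Choose it with `y - x` maximal. Working from long edges to short ones, the longer edges `[a, y]`
and `[x, d + n]` are in the set: otherwise a pair blocking one of them gives a pair blocking `[a,
d]`, a 3-crossing, or a larger `y - x`. But `[a, y]`, `[x, d + n]` and `[a + n, y + n]` form a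
3-crossing. -/

/-- The pairs `[i, j]` and `[k, l]` of integers, with `i < j` and `k < l`, interleave. -/
def Interleave (i j k l : ℤ) : Prop :=
  i < k ∧ k < j ∧ j < l ∨ k < i ∧ i < l ∧ l < j

/-! ### Lifting polygon 3-crossings to short edges -/

/-- A relation on `ℤ` that describes a set of edges of the `4n`-gon invariant under the rotation
by `n` vertices. -/
structure PolygonRel (n : ℤ) (P : ℤ → ℤ → Prop) : Prop where
  symm : ∀ {i j}, P i j → P j i
  shift : ∀ {i j}, P i j → ∀ k m : ℤ, P (i + k * n) (j + k * n + m * (4 * n))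

namespace PolygonRel

variable {n : ℤ} {P Q R : ℤ → ℤ → Prop}

theorem move (h : PolygonRel n P) {i j i' j' : ℤ} (hP : P i j) (k m : ℤ)
    (hi : i' = i + k * n) (hj : j' = j + k * n + m * (4 * n)) : P i' j' := by
  subst hi hj
  exact h.shift hP k m

theorem flip (h : PolygonRel n P) {i j i' j' : ℤ} (hP : P i j) (k m : ℤ)
    (hi : i' = j + k * n) (hj : j' = i + k * n + m * (4 * n)) : P i' j' :=
  h.move (h.symm hP) k m hi hj

/-- Three pairwise crossing edges of the `4n`-gon have pairwise crossing representatives of length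
at most `2n` on the universal cover, up to rotation by multiples of `n`. -/
theorem exists_interleave (hP : PolygonRel n P) (hQ : PolygonRel n Q) (hR : PolygonRel n R)
    {a b c d e f : ℤ} (hab : a < b) (hbc : b < c) (hcd : c < d) (hde : d < e) (hef : e < f)
    (hfa : f < a + 4 * n) (had : P a d) (hbe : Q b e) (hcf : R c f) :
    ∃ a' d' b' e' c' f' : ℤ, a' < d' ∧ d' ≤ a' + 2 * n ∧ b' < e' ∧ e' ≤ b' + 2 * n ∧
      c' < f' ∧ f' ≤ c' + 2 * n ∧ P a' d' ∧ Q b' e' ∧ R c' f' ∧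
      Interleave a' d' b' e' ∧ Interleave a' d' c' f' ∧ Interleave b' e' c' f' := by
  unfold Interleave
  have had' : P d (a + 4 * n) := hP.flip had 0 1 (by ring) (by ring)
  have hbe' : Q e (b + 4 * n) := hQ.flip hbe 0 1 (by ring) (by ring)
  have hcf' : R f (c + 4 * n) := hR.flip hcf 0 1 (by ring) (by ring)
  -- Each edge longer than `2n` is replaced by its complementary arc.
  rcases le_or_gt d (a + 2 * n) with h1 | h1 <;> rcases le_or_gt e (b + 2 * n) with h2 | h2 <;>
    rcases le_or_gt f (c + 2 * n) with h3 | h3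
  · exact ⟨a, d, b, e, c, f, by omega, by omega, by omega, by omega, by omega, by omega,
      had, hbe, hcf, by omega, by omega, by omega⟩
  · exact ⟨a, d, b, e, f - 4 * n, c, by omega, by omega, by omega, by omega, by omega, by omega,
      had, hbe, hR.flip hcf (-4) 1 (by ring) (by ring), by omega, by omega, by omega⟩
  -- When only the middle edge needs its complementary arc, that arc is moved by a half turn to meet
  -- both others. The case where only the middle edge is short is settled by a half turn of the
  -- third.
  · exact ⟨a, d, e - 2 * n, b + 2 * n, c, f, by omega, by omega, by omega, by omega, by omega,
      by omega, had, hQ.flip hbe (-2) 1 (by ring) (by ring), hcf, by omega, by omega, by omega⟩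
  · exact ⟨a, d, e - 4 * n, b, f - 4 * n, c, by omega, by omega, by omega, by omega, by omega,
      by omega, had, hQ.flip hbe (-4) 1 (by ring) (by ring),
      hR.flip hcf (-4) 1 (by ring) (by ring), by omega, by omega, by omega⟩
  · exact ⟨d, a + 4 * n, b, e, c, f, by omega, by omega, by omega, by omega, by omega, by omega,
      had', hbe, hcf, by omega, by omega, by omega⟩
  · exact ⟨d, a + 4 * n, b, e, f - 2 * n, c + 2 * n, by omega, by omega, by omega, by omega,
      by omega, by omega, had', hbe, hR.flip hcf (-2) 1 (by ring) (by ring), by omega, by omega,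
      by omega⟩
  · exact ⟨d, a + 4 * n, e, b + 4 * n, c, f, by omega, by omega, by omega, by omega, by omega,
      by omega, had', hbe', hcf, by omega, by omega, by omega⟩
  · exact ⟨d, a + 4 * n, e, b + 4 * n, f, c + 4 * n, by omega, by omega, by omega, by omega,
      by omega, by omega, had', hbe', hcf', by omega, by omega, by omega⟩

end PolygonRel

/-! ### Maximality among periodic sets implies maximality -/

/-- The `4n`-gon edges of `P` contain a `3`-crossing. -/
def HasTripleCrossing (n : ℤ) (P : ℤ → ℤ → Prop) : Prop :=
  ∃ a b c d e f : ℤ, a < b ∧ b < c ∧ c < d ∧ d < e ∧ e < f ∧ f < a + 4 * n ∧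
    P a d ∧ P b e ∧ P c f

/-- The edge `[a, d]` of the `4n`-gon crosses two edges of `P` that cross each other. -/
def Blocked (n : ℤ) (P : ℤ → ℤ → Prop) (a d : ℤ) : Prop :=
  ∃ b c e f : ℤ, a < b ∧ b < c ∧ c < d ∧ d < e ∧ e < f ∧ f < a + 4 * n ∧ P b e ∧ P c f

/-- The edge `[i, j]` belongs to `P` and has length at most `2n`, or is a translate of `[a, d]`. -/
def InExtension (n : ℤ) (P : ℤ → ℤ → Prop) (a d i j : ℤ) : Prop :=
  (P i j ∧ j ≤ i + 2 * n) ∨ ∃ k : ℤ, i = a + k * n ∧ j = d + k * n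

/-- Adding to `P` all translates of `[a, d]` creates a `3`-crossing on the universal cover. -/
def OrbitBlocked (n : ℤ) (P : ℤ → ℤ → Prop) (a d : ℤ) : Prop :=
  ∃ x₁ x₂ x₃ x₄ x₅ x₆ : ℤ, x₁ < x₂ ∧ x₂ < x₃ ∧ x₃ < x₄ ∧ x₄ < x₅ ∧ x₅ < x₆ ∧
    InExtension n P a d x₁ x₄ ∧ InExtension n P a d x₂ x₅ ∧ InExtension n P a d x₃ x₆

section Blocking

variable {n : ℤ} {P : ℤ → ℤ → Prop}

theorem blocked_of_translate (h : PolygonRel n P) {a d : ℤ} (k : ℤ) {a' d' : ℤ}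
    (ha : a' = a + k * n) (hd : d' = d + k * n) (hB : Blocked n P a' d') : Blocked n P a d := by
  obtain ⟨b, c, e, f, h1, h2, h3, h4, h5, h6, hbe, hcf⟩ := hB
  refine ⟨b - k * n, c - k * n, e - k * n, f - k * n, by linarith, by linarith, by linarith,
    by linarith, by linarith, by linarith, h.move hbe (-k) 0 (by ring) (by ring),
    h.move hcf (-k) 0 (by ring) (by ring)⟩

/-- A single edge of `P` that crosses `[a, d]` and `[a + n, d + n]` around both `a + n` and `d` is
short, unless it blocks `[a, d]` together with its translate. -/
theorem length_le_of_not_blocked (h : PolygonRel n P) {a d x y : ℤ} (hda : d ≤ a + 2 * n)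
    (hB : ¬ Blocked n P a d) (hxy : P x y) (hax : a < x) (hxa : x < a + n) (hdy : d < y)
    (hyd : y < d + n) : y ≤ x + n := by
  by_contra hlt
  -- The second blocking edge is the complementary arc `[y, x + 4n]` turned back by `n`.
  exact hB ⟨x, y - n, y, x + 3 * n, by omega, by omega, by omega, by omega, by omega, by omega,
    hxy, h.flip hxy (-1) 1 (by ring) (by ring)⟩

/-- Two crossing translates of an edge of length at most `2n` differ by exactly `n`. If the edge of
`P` comes first or last in the 3-crossing, then it and a translate of it by `n` already block a
translate of `[a, d]`; only the middle position survives. -/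
theorem exists_short_of_pair (h : PolygonRel n P) (hn : 0 < n) {a d : ℤ}
    (hda : d ≤ a + 2 * n) (hB : ¬ Blocked n P a d) {x y k l : ℤ} (hxy : P x y)
    (hlen : y ≤ x + 2 * n) (hkl : k < l) (hl : a + l * n < d + k * n)
    (hord : (x < a + k * n ∧ a + l * n < y ∧ y < d + k * n) ∨
      (a + k * n < x ∧ x < a + l * n ∧ d + k * n < y ∧ y < d + l * n) ∨
      (a + l * n < x ∧ x < d + k * n ∧ d + l * n < y)) :
    ∃ x y, P x y ∧ a < x ∧ x < a + n ∧ a + n < d ∧ d < y ∧ y < d + n := by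
  have hl1 : l = k + 1 := by
    have : (l - k) * n < 2 * n := by linarith
    have := lt_of_mul_lt_mul_right this hn.le
    omega
  subst hl1
  have hxy' : P (x - k * n) (y - k * n) := h.move hxy (-k) 0 (by ring) (by ring)
  obtain ⟨x', hx'⟩ : ∃ x', x' = x - k * n := ⟨_, rfl⟩
  obtain ⟨y', hy'⟩ : ∃ y', y' = y - k * n := ⟨_, rfl⟩
  rw [← hx', ← hy'] at hxy'
  obtain rfl : x = x' + k * n := by linarith
  obtain rfl : y = y' + k * n := by linarith
  have hk : (k + 1) * n = k * n + n := by ring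
  rw [hk] at hl hord
  generalize k * n = m at *
  rcases hord with ho | ho | ho
  · exact absurd ⟨x' + n, y', y' + n, x' + 4 * n, by omega, by omega, by omega, by omega,
      by omega, by omega, h.move hxy' 1 0 (by ring) (by ring),
      h.flip hxy' 0 1 (by ring) (by ring)⟩ hB
  · exact ⟨x', y', hxy', by omega, by omega, by omega, by omega, by omega⟩
  · exact absurd ⟨x' - n, x', y' - n, y', by omega, by omega, by omega, by omega,
      by omega, by omega, h.move hxy' (-1) 0 (by ring) (by ring), hxy'⟩ hB

/-- Count the translates of `[a, d]` in the 3-crossing: none contradicts `hfree`, one gives a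
blocking pair, and three would force `d - a > 2n`. So there are exactly two. -/
theorem exists_short_crossing (h : PolygonRel n P) (hn : 0 < n) (hfree : ¬ HasTripleCrossing n P)
    {a d : ℤ} (hda : d ≤ a + 2 * n) (hB : ¬ Blocked n P a d)
    (hO : OrbitBlocked n P a d) :
    ∃ x y, P x y ∧ a < x ∧ x < a + n ∧ a + n < d ∧ d < y ∧ y < d + n := by
  obtain ⟨x₁, x₂, x₃, x₄, x₅, x₆, h12, h23, h34, h45, h56, h14, h25, h36⟩ := hO
  rcases h14 with ⟨p1, l1⟩ | ⟨k, rfl, rfl⟩ <;> rcases h25 with ⟨p2, l2⟩ | ⟨l, rfl, rfl⟩ <;>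
    rcases h36 with ⟨p3, l3⟩ | ⟨m, rfl, rfl⟩
  · exact absurd ⟨_, _, _, _, _, _, h12, h23, h34, h45, h56, by omega, p1, p2, p3⟩ hfree
  · refine absurd (blocked_of_translate h m rfl rfl ⟨x₄, x₅, x₁ + 4 * n, x₂ + 4 * n, ?_⟩) hB
    exact ⟨h34, h45, h56, by omega, by omega, by omega, h.flip p1 0 1 (by ring) (by ring),
      h.flip p2 0 1 (by ring) (by ring)⟩
  · refine absurd (blocked_of_translate h l rfl rfl ⟨x₃, x₄, x₆, x₁ + 4 * n, ?_⟩) hB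
    exact ⟨h23, h34, h45, h56, by omega, by omega, p3, h.flip p1 0 1 (by ring) (by ring)⟩
  · exact exists_short_of_pair h hn hda hB p1 l1 (k := l) (l := m)
      (by by_contra hc; nlinarith) (by linarith) (Or.inl ⟨h12, h34, h45⟩)
  · refine absurd (blocked_of_translate h k rfl rfl ⟨x₂, x₃, x₅, x₆, ?_⟩) hB
    exact ⟨h12, h23, h34, h45, h56, by omega, p2, p3⟩
  · exact exists_short_of_pair h hn hda hB p2 l2 (k := k) (l := m)
      (by by_contra hc; nlinarith) (by linarith) (Or.inr (Or.inl ⟨h12, h23, h45, h56⟩))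
  · exact exists_short_of_pair h hn hda hB p3 l3 (k := k) (l := l)
      (by by_contra hc; nlinarith) (by linarith) (Or.inr (Or.inr ⟨h23, h34, h56⟩))
  · exfalso
    have hkl : k < l := by by_contra hc; nlinarith
    have hlm : l < m := by by_contra hc; nlinarith
    have : (k + 2) * n ≤ m * n := mul_le_mul_of_nonneg_right (by omega) hn.le
    linarith

/-- If a periodic `3`-crossing-free set of edges of the `4n`-gon is maximal among the periodic ones,
then it is maximal. -/
theorem blocked_of_orbitBlocked (h : PolygonRel n P) (hn : 0 < n)
    (hfree : ¬ HasTripleCrossing n P)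
    (hmax : ∀ a d, a < d → d ≤ a + 2 * n → ¬ P a d → OrbitBlocked n P a d)
    (t : ℕ) : ∀ a d, a < d → d ≤ a + 2 * n → a + 2 * n - d ≤ t → ¬ P a d → Blocked n P a d := by
  -- Induction on `2n` minus the length: longer edges are settled first.
  induction t using Nat.strong_induction_on with
  | _ t ih =>
  intro a d had hda ht hPad
  by_contra hB
  obtain ⟨x₀, y₀, hxy₀, h₀⟩ := exists_short_crossing h hn hfree hda hB (hmax a d had hda hPad)
  have hshort : ∀ x y, P x y → a < x → x < a + n → d < y → y < d + n → y ≤ x + n :=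
    fun x y hxy h1 h2 h3 h4 => length_le_of_not_blocked h hda hB hxy h1 h2 h3 h4
  obtain ⟨x, y, hxy, hax, hxa, hdy, hyd, hxymax⟩ : ∃ x y, P x y ∧ a < x ∧ x < a + n ∧ d < y ∧
      y < d + n ∧ ∀ x' y', P x' y' → a < x' → x' < a + n → d < y' → y' < d + n →
        y' - x' ≤ y - x := by
    have := Int.exists_greatest_of_bdd (P := fun z => ∃ x y, P x y ∧ a < x ∧ x < a + n ∧ d < y ∧
      y < d + n ∧ z = y - x) ⟨n, by
        rintro z ⟨x, y, hxy, h1, h2, h3, h4, rfl⟩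
        linarith [hshort x y hxy h1 h2 h3 h4]⟩
      ⟨y₀ - x₀, x₀, y₀, hxy₀, by omega, by omega, by omega, by omega, rfl⟩
    obtain ⟨z, ⟨x, y, hxy, h1, h2, h3, h4, rfl⟩, hz⟩ := this
    exact ⟨x, y, hxy, h1, h2, h3, h4, fun x' y' hxy' h1' h2' h3' h4' =>
      hz _ ⟨x', y', hxy', h1', h2', h3', h4', rfl⟩⟩
  have hand : a + n < d := h₀.2.2.1
  have hlen := hshort x y hxy hax hxa hdy hyd
  have hay : P a y := by
    by_contra hPay
    obtain ⟨p₁, q₁, p₂, q₂, h1, h2, h3, h4, h5, h6, hp, hq⟩ :=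
      ih (a + 2 * n - y).toNat (by omega) a y (by omega) (by omega) (by omega) hPay
    -- The pair `[p₁, p₂]`, `[q₁, q₂]` blocks `[a, y]`. In turn: it blocks `[a, d]`; it forms a
    -- 3-crossing with `[x, y]`; `[p₁, p₂]` beats the maximality of `y - x`; or `[q₁, q₂]` and `[x,
    -- y]` block `[a + n, d + n]`.
    rcases lt_or_ge q₁ d with hqd | hqd
    · exact hB ⟨p₁, q₁, p₂, q₂, h1, h2, hqd, by omega, h5, h6, hp, hq⟩
    rcases lt_or_ge x p₁ with hxp | hxp
    · exact hfree ⟨x, p₁, q₁, y, p₂, q₂, hxp, h2, h3, h4, h5, by omega, hxy, hp, hq⟩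
    rcases lt_or_ge p₂ (d + n) with hpd | hpd
    · have := hxymax p₁ p₂ hp h1 (by omega) (by omega) hpd
      omega
    · refine hB (blocked_of_translate h 1 (a' := a + n) (d' := d + n) (by ring) (by ring)
        ⟨q₁, y, q₂, x + 4 * n, ?_⟩)
      exact ⟨by omega, by omega, by omega, by omega, by omega, by omega, hq,
        h.flip hxy 0 1 (by ring) (by ring)⟩
  have hxd : P x (d + n) := by
    by_contra hPxd
    obtain ⟨p₁, q₁, p₂, q₂, h1, h2, h3, h4, h5, h6, hp, hq⟩ :=
      ih (x + n - d).toNat (by omega) x (d + n) (by omega) (by omega) (by omega) hPxd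
    -- The mirror argument; here `[q₂ - 4n, q₁]` is the competitor for maximality, and otherwise
    -- `[x, y]` and `[p₁, p₂]` block `[a, d]`.
    rcases lt_or_ge (a + n) p₁ with hpa | hpa
    · exact hB (blocked_of_translate h 1 (a' := a + n) (d' := d + n) (by ring) (by ring)
        ⟨p₁, q₁, p₂, q₂, by omega, h2, by omega, by omega, h5, by omega, hp, hq⟩)
    rcases lt_or_ge q₁ y with hqy | hqy
    · exact hfree ⟨x, p₁, q₁, y, p₂, q₂, h1, h2, hqy, by omega, h5, h6, hxy, hp, hq⟩
    rcases lt_or_ge (a + 4 * n) q₂ with hqa | hqa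
    · have := hxymax (q₂ - 4 * n) q₁ (h.flip hq (-4) 1 (by ring) (by ring)) (by omega) (by omega)
        (by omega) (by omega)
      omega
    · exact hB ⟨x, p₁, y, p₂, hax, h1, by omega, hdy, by omega, by omega, hxy, hp⟩
  exact hfree ⟨a, x, a + n, y, d + n, y + n, hax, hxa, by omega, by omega, by omega, by omega,
    hay, hxd, h.move hay 1 0 (by ring) (by ring)⟩

end Blocking

/-! ### Crossings in a cyclic order and on ℤ -/

section Crossings

variable {V : Type} [CircularOrder V]

theorem Edge.Crosses.symm {e f : Edge V} (h : e.Crosses f) : f.Crosses e := by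
  obtain ⟨a, b, c, d, he, hf, h1, h2⟩ := h
  exact ⟨c, d, b, a, hf, he.trans Sym2.eq_swap, (h2.cyclic_left.trans_left h1).cyclic_left,
    (h1.cyclic_left.trans_left h2).cyclic_left⟩

theorem Edge.Crosses.ne {e f : Edge V} (h : e.Crosses f) : e ≠ f := by
  rintro rfl
  obtain ⟨a, b, c, d, he, hf, h1, -⟩ := h
  rw [he, Sym2.eq_iff] at hf
  rcases hf with ⟨rfl, rfl⟩ | ⟨rfl, rfl⟩
  · exact sbtw_irrefl_left h1
  · exact sbtw_irrefl_right h1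

theorem isCrossing_three_of_crosses {e f g : Edge V} (hef : e.Crosses f) (heg : e.Crosses g)
    (hfg : f.Crosses g) : IsCrossing 3 ({e, f, g} : Set (Edge V)) := by
  refine ⟨?_, ?_⟩
  · exact Set.encard_eq_three.2 ⟨e, f, g, hef.ne, heg.ne, hfg.ne, rfl⟩
  · have := hef.symm
    have := heg.symm
    have := hfg.symm
    rintro x (rfl | rfl | rfl) y (rfl | rfl | rfl) hxy <;> first | assumption | exact absurd rfl hxy

theorem IsCrossing.exists_three {C : Set (Edge V)} (h : IsCrossing 3 C) :
    ∃ e f g, C = {e, f, g} ∧ e.Crosses f ∧ e.Crosses g ∧ f.Crosses g := by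
  obtain ⟨e, f, g, h1, h2, h3, rfl⟩ := Set.encard_eq_three.1 h.1
  exact ⟨e, f, g, rfl, h.2 (by simp) (by simp) h1, h.2 (by simp) (by simp) h2,
    h.2 (by simp) (by simp) h3⟩

end Crossings

/-- The edge with distinct end points `x` and `y`. -/
def Edge.mk {V : Type} (x y : V) (h : x ≠ y) : Edge V := ⟨s(x, y), by simpa using h⟩

theorem Edge.exists_lt (e : Edge ℤ) : ∃ i j : ℤ, i < j ∧ e.1 = s(i, j) := by
  obtain ⟨⟨i, j⟩, h⟩ := e
  have hij : i ≠ j := by simpa using h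
  rcases lt_or_gt_of_ne hij with h | h
  · exact ⟨i, j, h, rfl⟩
  · exact ⟨j, i, h, Sym2.eq_swap⟩

theorem Edge.length_eq {e : Edge ℤ} {i j : ℤ} (h : e.1 = s(i, j)) :
    e.length = (j - i).natAbs := by
  simp [Edge.length, h]

theorem Edge.translate_val {V : Type} [AddGroup V] {e : Edge V} {x y : V} (h : e.1 = s(x, y))
    (t : V) : (e.translate t).1 = s(x + t, y + t) := by
  simp [Edge.translate, h]

theorem crosses_int_iff {e f : Edge ℤ} {i j k l : ℤ} (he : e.1 = s(i, j)) (hf : f.1 = s(k, l))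
    (hij : i < j) (hkl : k < l) : e.Crosses f ↔ Interleave i j k l := by
  unfold Interleave
  constructor
  · rintro ⟨a, b, c, d, he', hf', h1, h2⟩
    rw [he, Sym2.eq_iff] at he'
    rw [hf, Sym2.eq_iff] at hf'
    rw [Int.sbtw_iff] at h1 h2
    omega
  · rintro (h | h)
    · exact ⟨i, j, k, l, he, hf, Int.sbtw_iff.2 (by omega), Int.sbtw_iff.2 (by omega)⟩
    · exact ⟨i, j, l, k, he, hf.trans Sym2.eq_swap, Int.sbtw_iff.2 (by omega),
        Int.sbtw_iff.2 (by omega)⟩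

/-! ### Crossings of residues read off in a window of `N` integers -/

section ZMod

variable {N : ℕ} [NeZero N]

theorem sbtw_iff_val_lt {x y z : ZMod N} : sbtw x y z ↔
    x.val < y.val ∧ y.val < z.val ∨ y.val < z.val ∧ z.val < x.val ∨
      z.val < x.val ∧ x.val < y.val := by
  cases N with
  | zero => exact absurd rfl (NeZero.ne 0)
  | succ m => exact Fin.sbtw_iff

/-- The residues of the integers of the window `[w, w + N)` are a rotation of the window. -/
theorem val_intCast_window (w : ℤ) : ∃ r : ℤ, 0 ≤ r ∧ r < N ∧ ∀ i : ℤ, w ≤ i → i < w + N →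
    (((i : ZMod N).val : ℤ) = r + (i - w) ∧ r + (i - w) < N ∨
      ((i : ZMod N).val : ℤ) = r + (i - w) - N ∧ N ≤ r + (i - w)) := by
  have hN : (0 : ℤ) < N := by exact_mod_cast NeZero.pos N
  refine ⟨w % N, Int.emod_nonneg _ hN.ne', Int.emod_lt_of_pos _ hN, fun i h1 h2 => ?_⟩
  have hr0 := Int.emod_nonneg w hN.ne'
  have hr1 := Int.emod_lt_of_pos w hN
  rw [ZMod.val_intCast]
  have key : i % N = (w % N + (i - w)) % N := by
    rw [Int.emod_add_emod, add_sub_cancel]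
  rcases lt_or_ge (w % N + (i - w)) N with h | h
  · left
    exact ⟨by rw [key, Int.emod_eq_of_lt (by omega) h], h⟩
  · right
    refine ⟨?_, h⟩
    rw [key, ← Int.sub_emod_right, Int.emod_eq_of_lt (by omega) (by omega)]

theorem sbtw_intCast_iff {w i j k : ℤ} (hi : w ≤ i) (hi' : i < w + N) (hj : w ≤ j)
    (hj' : j < w + N) (hk : w ≤ k) (hk' : k < w + N) :
    sbtw (i : ZMod N) j k ↔ sbtw i j k := by
  rw [sbtw_iff_val_lt, Int.sbtw_iff]
  obtain ⟨r, h0, h1, hr⟩ := val_intCast_window (N := N) w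
  have ha := hr i hi hi'
  have hb := hr j hj hj'
  have hc := hr k hk hk'
  omega

theorem intCast_inj_of_window {w i j : ℤ} (hi : w ≤ i) (hi' : i < w + N) (hj : w ≤ j)
    (hj' : j < w + N) (h : (i : ZMod N) = j) : i = j := by
  obtain ⟨r, h0, h1, hr⟩ := val_intCast_window (N := N) w
  have ha := hr i hi hi'
  have hb := hr j hj hj'
  rw [h] at ha
  omega

theorem exists_intCast_window (w : ℤ) (x : ZMod N) :
    ∃ i : ℤ, w ≤ i ∧ i < w + N ∧ (i : ZMod N) = x := by
  have hN : (0 : ℤ) < N := by exact_mod_cast NeZero.pos N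
  obtain ⟨j, rfl⟩ := ZMod.intCast_surjective x
  refine ⟨w + (j - w) % N, ?_, ?_, ?_⟩
  · linarith [Int.emod_nonneg (j - w) hN.ne']
  · linarith [Int.emod_lt_of_pos (j - w) hN]
  · simp

theorem Edge.exists_window (w : ℤ) (e : Edge (ZMod N)) :
    ∃ i j : ℤ, w ≤ i ∧ i < j ∧ j < w + N ∧ e.1 = s((i : ZMod N), (j : ZMod N)) := by
  obtain ⟨⟨x, y⟩, h⟩ := e
  have hxy : x ≠ y := by simpa using h
  obtain ⟨i, h1, h2, rfl⟩ := exists_intCast_window w x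
  obtain ⟨j, h3, h4, rfl⟩ := exists_intCast_window w y
  have hij : i ≠ j := fun h => hxy (by rw [h])
  rcases lt_or_gt_of_ne hij with h | h
  · exact ⟨i, j, h1, h, h4, rfl⟩
  · exact ⟨j, i, h3, h, h2, Sym2.eq_swap⟩

theorem crosses_intCast_iff {e f : Edge (ZMod N)} {w i j k l : ℤ}
    (he : e.1 = s((i : ZMod N), (j : ZMod N))) (hf : f.1 = s((k : ZMod N), (l : ZMod N)))
    (hi : w ≤ i) (hij : i < j) (hj : j < w + N) (hk : w ≤ k) (hkl : k < l) (hl : l < w + N) :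
    e.Crosses f ↔ Interleave i j k l := by
  have hdiag {x y : ℤ} (h : x < y) : ¬ s(x, y).IsDiag := by simpa using h.ne
  rw [← crosses_int_iff (e := ⟨s(i, j), hdiag hij⟩) (f := ⟨s(k, l), hdiag hkl⟩) rfl rfl hij hkl]
  have key {x y z : ℤ} (hx : x = i ∨ x = j ∨ x = k ∨ x = l) (hy : y = i ∨ y = j ∨ y = k ∨ y = l)
      (hz : z = i ∨ z = j ∨ z = k ∨ z = l) : sbtw (x : ZMod N) y z ↔ sbtw x y z :=
    sbtw_intCast_iff (w := w) (by omega) (by omega) (by omega) (by omega) (by omega) (by omega)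
  constructor
  · rintro ⟨a, b, c, d, he', hf', h1, h2⟩
    rw [he, Sym2.eq_iff] at he'
    rw [hf, Sym2.eq_iff] at hf'
    rcases he' with ⟨rfl, rfl⟩ | ⟨rfl, rfl⟩ <;> rcases hf' with ⟨rfl, rfl⟩ | ⟨rfl, rfl⟩ <;>
      rw [key (by simp) (by simp) (by simp)] at h1 h2
    · exact ⟨i, j, k, l, rfl, rfl, h1, h2⟩
    · exact ⟨i, j, l, k, rfl, Sym2.eq_swap, h1, h2⟩
    · exact ⟨j, i, k, l, Sym2.eq_swap, rfl, h1, h2⟩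
    · exact ⟨j, i, l, k, Sym2.eq_swap, Sym2.eq_swap, h1, h2⟩
  · rintro ⟨a, b, c, d, he', hf', h1, h2⟩
    have hab : a = i ∧ b = j ∨ a = j ∧ b = i := by
      have := Sym2.eq_iff.1 he'
      omega
    have hcd : c = k ∧ d = l ∨ c = l ∧ d = k := by
      have := Sym2.eq_iff.1 hf'
      omega
    refine ⟨a, b, c, d, ?_, ?_, (key (by omega) (by omega) (by omega)).2 h1,
      (key (by omega) (by omega) (by omega)).2 h2⟩
    · rw [he]
      rcases hab with ⟨rfl, rfl⟩ | ⟨rfl, rfl⟩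
      exacts [rfl, Sym2.eq_swap]
    · rw [hf]
      rcases hcd with ⟨rfl, rfl⟩ | ⟨rfl, rfl⟩
      exacts [rfl, Sym2.eq_swap]

end ZMod

/-! ### 3-crossings as chains of six vertices -/

theorem IsCrossing.exists_int_chain {C : Set (Edge ℤ)} (h : IsCrossing 3 C) :
    ∃ (a b c d e f : ℤ) (g₁ g₂ g₃ : Edge ℤ), a < b ∧ b < c ∧ c < d ∧ d < e ∧ e < f ∧
      C = {g₁, g₂, g₃} ∧ g₁.1 = s(a, d) ∧ g₂.1 = s(b, e) ∧ g₃.1 = s(c, f) := by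
  obtain ⟨e₁, e₂, e₃, rfl, h12, h13, h23⟩ := h.exists_three
  obtain ⟨a, d, had, h1⟩ := e₁.exists_lt
  obtain ⟨b, e, hbe, h2⟩ := e₂.exists_lt
  obtain ⟨c, f, hcf, h3⟩ := e₃.exists_lt
  rw [crosses_int_iff h1 h2 had hbe] at h12
  rw [crosses_int_iff h1 h3 had hcf] at h13
  rw [crosses_int_iff h2 h3 hbe hcf] at h23
  unfold Interleave at *
  rcases h12 with h12 | h12 <;> rcases h13 with h13 | h13 <;> rcases h23 with h23 | h23
  · exact ⟨a, b, c, d, e, f, e₁, e₂, e₃, by omega, by omega, by omega, by omega, by omega,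
      rfl, h1, h2, h3⟩
  · exact ⟨a, c, b, d, f, e, e₁, e₃, e₂, by omega, by omega, by omega, by omega, by omega,
      by grind, h1, h3, h2⟩
  · omega
  · exact ⟨c, a, b, f, d, e, e₃, e₁, e₂, by omega, by omega, by omega, by omega, by omega,
      by grind, h3, h1, h2⟩
  · exact ⟨b, a, c, e, d, f, e₂, e₁, e₃, by omega, by omega, by omega, by omega, by omega,
      by grind, h2, h1, h3⟩
  · omega
  · exact ⟨b, c, a, e, f, d, e₂, e₃, e₁, by omega, by omega, by omega, by omega, by omega,
      by grind, h2, h3, h1⟩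
  · exact ⟨c, b, a, f, e, d, e₃, e₂, e₁, by omega, by omega, by omega, by omega, by omega,
      by grind, h3, h2, h1⟩

theorem IsCrossing.exists_zmod_chain {N : ℕ} [NeZero N] {C : Set (Edge (ZMod N))}
    (h : IsCrossing 3 C) :
    ∃ (a b c d e f : ℤ) (g₁ g₂ g₃ : Edge (ZMod N)), a < b ∧ b < c ∧ c < d ∧ d < e ∧ e < f ∧
      f < a + N ∧ C = {g₁, g₂, g₃} ∧ g₁.1 = s((a : ZMod N), (d : ZMod N)) ∧
      g₂.1 = s((b : ZMod N), (e : ZMod N)) ∧ g₃.1 = s((c : ZMod N), (f : ZMod N)) := by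
  obtain ⟨e₁, e₂, e₃, rfl, h12, h13, h23⟩ := h.exists_three
  -- Cutting the circle at the vertex `a` of the first edge makes it the smallest of the six, so
  -- only the order of the other two edges is undecided.
  obtain ⟨a, d, ha, had, hd, h1⟩ := e₁.exists_window 0
  obtain ⟨b, e, hb, hbe, he, h2⟩ := e₂.exists_window a
  obtain ⟨c, f, hc, hcf, hf, h3⟩ := e₃.exists_window a
  rw [crosses_intCast_iff (w := a) h1 h2 le_rfl had (by omega) hb hbe he] at h12
  rw [crosses_intCast_iff (w := a) h1 h3 le_rfl had (by omega) hc hcf hf] at h13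
  rw [crosses_intCast_iff (w := a) h2 h3 hb hbe he hc hcf hf] at h23
  unfold Interleave at *
  rcases h23 with h23 | h23
  · exact ⟨a, b, c, d, e, f, e₁, e₂, e₃, by omega, by omega, by omega, by omega, by omega,
      by omega, rfl, h1, h2, h3⟩
  · exact ⟨a, c, b, d, f, e, e₁, e₃, e₂, by omega, by omega, by omega, by omega, by omega,
      by omega, by grind, h1, h3, h2⟩

theorem isCrossing_of_zmod_chain {N : ℕ} [NeZero N] {a b c d e f : ℤ} {g₁ g₂ g₃ : Edge (ZMod N)}
    (hab : a < b) (hbc : b < c) (hcd : c < d) (hde : d < e) (hef : e < f) (hfa : f < a + N)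
    (h1 : g₁.1 = s((a : ZMod N), (d : ZMod N))) (h2 : g₂.1 = s((b : ZMod N), (e : ZMod N)))
    (h3 : g₃.1 = s((c : ZMod N), (f : ZMod N))) :
    IsCrossing 3 ({g₁, g₂, g₃} : Set (Edge (ZMod N))) := by
  refine isCrossing_three_of_crosses ?_ ?_ ?_
  · exact (crosses_intCast_iff (w := a) h1 h2 (by omega) (by omega) (by omega) (by omega)
      (by omega) (by omega)).2 (Or.inl (by omega))
  · exact (crosses_intCast_iff (w := a) h1 h3 (by omega) (by omega) (by omega) (by omega)
      (by omega) (by omega)).2 (Or.inl (by omega))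
  · exact (crosses_intCast_iff (w := a) h2 h3 (by omega) (by omega) (by omega) (by omega)
      (by omega) (by omega)).2 (Or.inl (by omega))

/-! ### Edge sets as relations; periodicity -/

/-- The set `S` contains the edge `[x, y]`. -/
def Joins {V : Type} (S : Set (Edge V)) (x y : V) : Prop := ∃ e ∈ S, e.1 = s(x, y)

theorem Joins.symm {V : Type} {S : Set (Edge V)} {x y : V} (h : Joins S x y) : Joins S y x := by
  obtain ⟨e, he, h⟩ := h
  exact ⟨e, he, h.trans Sym2.eq_swap⟩

theorem Joins.mono {V : Type} {S T : Set (Edge V)} {x y : V} (h : Joins S x y) (hST : S ⊆ T) :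
    Joins T x y := by
  obtain ⟨e, he, h⟩ := h
  exact ⟨e, hST he, h⟩

theorem Joins.mem {V : Type} {S : Set (Edge V)} {x y : V} (h : Joins S x y) {e : Edge V}
    (he : e.1 = s(x, y)) : e ∈ S := by
  obtain ⟨f, hf, h⟩ := h
  rwa [Subtype.ext (he.trans h.symm)]

section Translation

variable {V : Type} [AddGroup V]

theorem Edge.translate_translate (e : Edge V) (s t : V) :
    (e.translate s).translate t = e.translate (s + t) := by
  apply Subtype.ext
  simp [Edge.translate, Sym2.map_map, add_assoc]

theorem Edge.translate_zero (e : Edge V) : e.translate 0 = e := by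
  apply Subtype.ext
  simp [Edge.translate]

end Translation

theorem isPeriodic_iff {N n : ℕ} {S : Set (Edge (ZMod N))} :
    IsPeriodic N n S ↔ ∀ e ∈ S, ∀ k : ℤ, e.translate ((k * n : ℤ) : ZMod N) ∈ S := by
  constructor
  · intro h e he k
    induction k using Int.induction_on with
    | zero => simpa [Edge.translate_zero] using he
    | succ k ih =>
      have := (h _).1 ih
      rw [Edge.translate_translate] at this
      convert this using 2
      push_cast
      ring
    | pred k ih =>
      refine (h _).2 ?_
      rw [Edge.translate_translate]
      convert ih using 2
      push_cast
      ring
  · intro h e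
    refine ⟨fun he => by simpa using h e he 1, fun he => ?_⟩
    have := h _ he (-1)
    rw [Edge.translate_translate] at this
    simpa [Edge.translate_zero] using this

theorem polygonRel_of_isPeriodic {n : ℕ} {S : Set (Edge (ZMod (4 * n)))}
    (h : IsPeriodic (4 * n) n S) :
    PolygonRel n (fun i j => Joins S (i : ZMod (4 * n)) (j : ZMod (4 * n))) where
  symm hij := hij.symm
  shift := by
    rintro i j ⟨e, he, hij⟩ k m
    refine ⟨_, isPeriodic_iff.1 h e he k, ?_⟩
    rw [Edge.translate_val hij]
    have : (4 * n : ZMod (4 * n)) = 0 := by exact_mod_cast ZMod.natCast_self (4 * n)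
    push_cast
    rw [this, mul_zero, add_zero]

/-! ### The map φ on sets of short edges -/

section Cylinder

variable {n : ℕ}

theorem proj_translate (e : Edge ℤ) (k : ℤ) : proj n (e.translate (k * n)) = proj n e :=
  (Quotient.sound (s := deckSetoid n) ⟨k, rfl⟩).symm

theorem proj_eq_iff {e f : Edge ℤ} : proj n e = proj n f ↔ ∃ k : ℤ, f = e.translate (k * n) :=
  Quotient.eq (r := deckSetoid n)

theorem exists_proj (x : CylinderEdge n) : ∃ e, proj n e = x := Quotient.exists_rep x

theorem translate_mem_lift {E : Set (CylinderEdge n)} {e : Edge ℤ} (he : e ∈ lift n E) (k : ℤ) :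
    e.translate (k * n) ∈ lift n E := by
  change proj n _ ∈ E
  rw [proj_translate]
  exact he

theorem Joins.shift_lift {E : Set (CylinderEdge n)} {i j : ℤ} (h : Joins (lift n E) i j) (k : ℤ) :
    Joins (lift n E) (i + k * n) (j + k * n) := by
  obtain ⟨e, he, hij⟩ := h
  exact ⟨_, translate_mem_lift he k, Edge.translate_val hij _⟩

theorem length_translate (e : Edge ℤ) (t : ℤ) : (e.translate t).length = e.length := by
  obtain ⟨i, j, -, h⟩ := e.exists_lt
  rw [Edge.length_eq h, Edge.length_eq (Edge.translate_val h t), add_sub_add_right_eq_sub]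

theorem length_le_of_val {e : Edge ℤ} {i j : ℤ} (h : e.1 = s(i, j)) (hlt : i < j)
    (hle : j ≤ i + 2 * n) : e.length ≤ 2 * n := by
  rw [Edge.length_eq h]
  omega

theorem le_of_length_le {e : Edge ℤ} {i j : ℤ} (h : e.1 = s(i, j))
    (hle : e.length ≤ 2 * n) : j ≤ i + 2 * n := by
  rw [Edge.length_eq h] at hle
  omega

theorem lengthLE_image_proj {C : Set (Edge ℤ)} {L : ℕ} (h : ∀ e ∈ C, e.length ≤ L) :
    LengthLE n L (proj n '' C) := by
  rintro e ⟨c, hc, hce⟩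
  obtain ⟨k, rfl⟩ := proj_eq_iff.1 hce
  rw [length_translate]
  exact h c hc

theorem Edge.reduce_ne (hn : 0 < n) {i j : ℤ} (hlt : i < j) (hle : j ≤ i + 2 * n) :
    (i : ZMod (4 * n)) ≠ (j : ZMod (4 * n)) := by
  have : NeZero (4 * n) := ⟨by omega⟩
  intro h
  have := intCast_inj_of_window (w := i) le_rfl (by push_cast; omega) hlt.le
    (by push_cast; omega) h
  omega

theorem mem_reduceMod {N : ℕ} {S : Set (Edge ℤ)} {g : Edge ℤ} (hg : g ∈ S) {i j : ℤ}
    (h : g.1 = s(i, j)) {e : Edge (ZMod N)} (he : e.1 = s((i : ZMod N), (j : ZMod N))) :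
    e ∈ reduceMod N S :=
  ⟨g, hg, by rw [he, h]; rfl⟩

theorem exists_of_mem_reduceMod {N : ℕ} {S : Set (Edge ℤ)} {e : Edge (ZMod N)}
    (h : e ∈ reduceMod N S) :
    ∃ g ∈ S, ∃ i j : ℤ, i < j ∧ g.1 = s(i, j) ∧ e.1 = s((i : ZMod N), (j : ZMod N)) := by
  obtain ⟨g, hg, he⟩ := h
  obtain ⟨i, j, hij, h⟩ := g.exists_lt
  exact ⟨g, hg, i, j, hij, h, by rw [he, h]; rfl⟩

theorem isPeriodic_toPolygon (E : Set (CylinderEdge n)) :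
    IsPeriodic (4 * n) n (toPolygon n E) := by
  rw [isPeriodic_iff]
  intro e he k
  obtain ⟨g, hg, i, j, -, hij, he⟩ := exists_of_mem_reduceMod he
  refine mem_reduceMod (translate_mem_lift hg k) (Edge.translate_val hij _) ?_
  rw [Edge.translate_val he]
  push_cast
  rfl

theorem toPolygon_mono {E F : Set (CylinderEdge n)} (h : E ⊆ F) :
    toPolygon n E ⊆ toPolygon n F := by
  rintro e ⟨g, hg, he⟩
  exact ⟨g, h hg, he⟩

theorem Joins.toPolygon (hn : 0 < n) {E : Set (CylinderEdge n)} {i j : ℤ} (hlt : i < j)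
    (hle : j ≤ i + 2 * n) (h : Joins (lift n E) i j) :
    Joins (toPolygon n E) (i : ZMod (4 * n)) (j : ZMod (4 * n)) := by
  obtain ⟨g, hg, h⟩ := h
  exact ⟨Edge.mk _ _ (Edge.reduce_ne hn hlt hle), mem_reduceMod hg h rfl, rfl⟩

/-- A set of cylinder edges of length at most `2n` is determined by its image in the `4n`-gon. -/
theorem Joins.of_toPolygon (hn : 0 < n) {E : Set (CylinderEdge n)} (hE : LengthLE n (2 * n) E)
    {i j : ℤ} (hlt : i < j) (hle : j ≤ i + 2 * n)
    (h : Joins (HalfCylinder.toPolygon n E) (i : ZMod (4 * n)) (j : ZMod (4 * n))) :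
    Joins (lift n E) i j := by
  obtain ⟨e, he, hij⟩ := h
  obtain ⟨g, hg, k, l, hkl, hg', he'⟩ := exists_of_mem_reduceMod he
  have hlen := le_of_length_le hg' (hE g hg)
  have hJ : Joins (lift n E) k l := ⟨g, hg, hg'⟩
  have hn' : (0 : ℤ) < 4 * n := by omega
  rw [he', Sym2.eq_iff] at hij
  simp only [ZMod.intCast_eq_intCast_iff_dvd_sub] at hij
  push_cast at hij
  rcases hij with ⟨⟨p, hp⟩, ⟨q, hq⟩⟩ | ⟨⟨p, hp⟩, ⟨q, hq⟩⟩
  -- Same orientation: two lengths in `(0, 2n]` that agree modulo `4n` are equal.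
  · have h1 : 4 * (n : ℤ) * (q - p) = (j - i) - (l - k) := by linarith
    have hqp : q = p := by
      have h2 : q - p < 1 := by
        refine lt_of_mul_lt_mul_left (a := 4 * (n : ℤ)) ?_ hn'.le
        omega
      have h3 : -1 < q - p := by
        refine lt_of_mul_lt_mul_left (a := 4 * (n : ℤ)) ?_ hn'.le
        omega
      omega
    subst hqp
    convert hJ.shift_lift (4 * q) using 1 <;> linarith
  -- Opposite orientation: the lengths add up to `4n`, so both are `2n`, and the edges differ by an
  -- odd multiple of `2n`.
  · have h1 : 4 * (n : ℤ) * (p - q) = (j - i) + (l - k) := by linarith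
    have hqp : p = q + 1 := by
      have h2 : p - q < 2 := by
        refine lt_of_mul_lt_mul_left (a := 4 * (n : ℤ)) ?_ hn'.le
        omega
      have h3 : 0 < p - q := by
        refine lt_of_mul_lt_mul_left (a := 4 * (n : ℤ)) ?_ hn'.le
        omega
      omega
    subst hqp
    have h4 : j - i = 2 * n ∧ l - k = 2 * n := by
      have : 4 * (n : ℤ) * (q + 1 - q) = 4 * n := by ring
      omega
    convert hJ.shift_lift (4 * q + 2) using 1 <;> linarith

theorem subset_of_toPolygon_subset (hn : 0 < n) {E F : Set (CylinderEdge n)}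
    (hE : LengthLE n (2 * n) E) (hF : LengthLE n (2 * n) F)
    (h : toPolygon n E ⊆ toPolygon n F) : E ⊆ F := by
  intro x hx
  obtain ⟨g, rfl⟩ := exists_proj x
  obtain ⟨i, j, hij, hg⟩ := g.exists_lt
  have hle := le_of_length_le hg (hE g hx)
  have hJ : Joins (lift n E) i j := ⟨g, hx, hg⟩
  exact (Joins.of_toPolygon hn hF hij hle ((hJ.toPolygon hn hij hle).mono h)).mem hg

theorem injOn_toPolygon (hn : 0 < n) :
    Set.InjOn (toPolygon n) {E | LengthLE n (2 * n) E} := fun _ hE _ hF h =>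
  (subset_of_toPolygon_subset hn hE hF h.subset).antisymm
    (subset_of_toPolygon_subset hn hF hE h.superset)

/-- Every edge of the `4n`-gon is the reduction of an edge of length at most `2n`. -/
theorem Edge.exists_short (hn : 0 < n) (e : Edge (ZMod (4 * n))) :
    ∃ i j : ℤ, i < j ∧ j ≤ i + 2 * n ∧ e.1 = s((i : ZMod (4 * n)), (j : ZMod (4 * n))) := by
  have : NeZero (4 * n) := ⟨by omega⟩
  obtain ⟨i, j, hi, hij, hj, h⟩ := e.exists_window 0
  push_cast at hj
  rcases le_or_gt j (i + 2 * n) with hle | hlt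
  · exact ⟨i, j, hij, hle, h⟩
  · refine ⟨j, i + ((4 * n : ℕ) : ℤ), by push_cast; omega, by push_cast; omega, ?_⟩
    rw [h, Int.cast_add, Int.cast_natCast, ZMod.natCast_self, add_zero]
    exact Sym2.eq_swap

theorem bijOn_toPolygon_lengthLE (hn : 0 < n) :
    Set.BijOn (toPolygon n) {E | LengthLE n (2 * n) E} {S | IsPeriodic (4 * n) n S} := by
  refine ⟨fun E _ => isPeriodic_toPolygon E, injOn_toPolygon hn, fun S hS => ?_⟩
  -- All short lifts of edges of `S`. Periodicity of `S` ensures that projecting and lifting again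
  -- adds nothing new in the polygon.
  let D : Set (Edge ℤ) := {g | g.length ≤ 2 * n ∧
    ∃ e ∈ S, e.1 = g.1.map (fun i : ℤ => (i : ZMod (4 * n)))}
  refine ⟨proj n '' D, lengthLE_image_proj fun g hg => hg.1, ?_⟩
  ext e
  constructor
  · rintro ⟨g, ⟨f, ⟨-, e', he', hf⟩, hfg⟩, he⟩
    obtain ⟨k, rfl⟩ := proj_eq_iff.1 hfg
    obtain ⟨i, j, -, hij⟩ := f.exists_lt
    have := isPeriodic_iff.1 hS e' he' k
    convert this
    apply Subtype.ext
    rw [hij, Sym2.map_mk] at hf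
    rw [he, Edge.translate_val hf, Edge.translate_val hij, Sym2.map_mk]
    push_cast
    rfl
  · intro he
    obtain ⟨i, j, hij, hle, h⟩ := e.exists_short hn
    exact ⟨Edge.mk i j hij.ne,
      ⟨Edge.mk i j hij.ne, ⟨length_le_of_val rfl hij hle, e, he, h⟩, rfl⟩, h⟩

/-- Reduction modulo `4n` sends a `3`-crossing of edges of length at most `2n` to a `3`-crossing. -/
theorem IsCrossing.reduceMod (hn : 0 < n) {C : Set (Edge ℤ)}
    (hlen : ∀ e ∈ C, e.length ≤ 2 * n) (hC : IsCrossing 3 C) :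
    IsCrossing 3 (reduceMod (4 * n) C) := by
  have : NeZero (4 * n) := ⟨by omega⟩
  obtain ⟨a, b, c, d, e, f, g₁, g₂, g₃, hab, hbc, hcd, hde, hef, rfl, h1, h2, h3⟩ :=
    hC.exists_int_chain
  have l1 := le_of_length_le h1 (hlen g₁ (by simp))
  have l2 := le_of_length_le h2 (hlen g₂ (by simp))
  have l3 := le_of_length_le h3 (hlen g₃ (by simp))
  have n1 := Edge.reduce_ne hn (show a < d by omega) l1
  have n2 := Edge.reduce_ne hn (show b < e by omega) l2
  have n3 := Edge.reduce_ne hn (show c < f by omega) l3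
  -- The chain fits into one window: `f ≤ c + 2n < d + 2n ≤ a + 4n`.
  have key := isCrossing_of_zmod_chain (N := 4 * n) (g₁ := Edge.mk _ _ n1)
    (g₂ := Edge.mk _ _ n2) (g₃ := Edge.mk _ _ n3) hab hbc hcd hde hef (by push_cast; omega)
    rfl rfl rfl
  convert key
  ext x
  constructor
  · rintro ⟨g, (rfl | rfl | rfl), hx⟩
    · left; exact Subtype.ext (by rw [hx, h1]; rfl)
    · right; left; exact Subtype.ext (by rw [hx, h2]; rfl)
    · right; right; exact Subtype.ext (by rw [hx, h3]; rfl)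
  · rintro (rfl | rfl | rfl)
    · exact mem_reduceMod (by simp) h1 rfl
    · exact mem_reduceMod (by simp) h2 rfl
    · exact mem_reduceMod (by simp) h3 rfl

theorem isCrossing_of_interleave {a b c d e f : ℤ} (had : a < d) (hbe : b < e) (hcf : c < f)
    (h12 : Interleave a d b e) (h13 : Interleave a d c f) (h23 : Interleave b e c f) :
    IsCrossing 3 ({Edge.mk a d had.ne, Edge.mk b e hbe.ne, Edge.mk c f hcf.ne} : Set (Edge ℤ)) :=
  isCrossing_three_of_crosses ((crosses_int_iff rfl rfl had hbe).2 h12)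
    ((crosses_int_iff rfl rfl had hcf).2 h13) ((crosses_int_iff rfl rfl hbe hcf).2 h23)

theorem crossingFree_lift_iff (hn : 0 < n) {E : Set (CylinderEdge n)}
    (hE : LengthLE n (2 * n) E) :
    CrossingFree 3 (lift n E) ↔ CrossingFree 3 (toPolygon n E) := by
  have : NeZero (4 * n) := ⟨by omega⟩
  constructor
  · intro h C hCE hC
    obtain ⟨a, b, c, d, e, f, g₁, g₂, g₃, hab, hbc, hcd, hde, hef, hfa, rfl, h1, h2, h3⟩ :=
      hC.exists_zmod_chain
    have hP := polygonRel_of_isPeriodic (isPeriodic_toPolygon E)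
    push_cast at hfa
    obtain ⟨a', d', b', e', c', f', had, had', hbe, hbe', hcf, hcf', p1, p2, p3, x1, x2, x3⟩ :=
      hP.exists_interleave hP hP hab hbc hcd hde hef hfa ⟨g₁, hCE (by simp), h1⟩
        ⟨g₂, hCE (by simp), h2⟩ ⟨g₃, hCE (by simp), h3⟩
    refine h _ ?_ (isCrossing_of_interleave had hbe hcf x1 x2 x3)
    rintro g (rfl | rfl | rfl)
    · exact (Joins.of_toPolygon hn hE had had' p1).mem rfl
    · exact (Joins.of_toPolygon hn hE hbe hbe' p2).mem rfl
    · exact (Joins.of_toPolygon hn hE hcf hcf' p3).mem rfl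
  · intro h C hCE hC
    refine h (reduceMod (4 * n) C) ?_ (hC.reduceMod hn fun e he => hE e (hCE he))
    rintro e ⟨g, hg, he⟩
    exact ⟨g, hCE hg, he⟩

/-! ### Rotation orbits and 3-crossings on the cylinder -/

section RotationOrbit

theorem exists_nat_mul_eq (n : ℕ) (k : ℤ) :
    ∃ l : ℕ, ((l * n : ℕ) : ZMod (4 * n)) = ((k * n : ℤ) : ZMod (4 * n)) := by
  refine ⟨(k % 4).toNat, ?_⟩
  rw [← Int.cast_natCast, ZMod.intCast_eq_intCast_iff_dvd_sub]
  refine ⟨k / 4, ?_⟩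
  push_cast
  rw [Int.toNat_of_nonneg (Int.emod_nonneg k (by norm_num))]
  linear_combination (-(n : ℤ)) * (Int.emod_add_mul_ediv k 4)

theorem mem_rotationOrbit {S : Set (Edge (ZMod (4 * n)))} {e : Edge (ZMod (4 * n))} :
    e ∈ rotationOrbit (4 * n) n S ↔
      ∃ f ∈ S, ∃ k : ℤ, e = f.translate ((k * n : ℤ) : ZMod (4 * n)) := by
  constructor
  · rintro ⟨f, hf, l, rfl⟩
    exact ⟨f, hf, l, by push_cast; rfl⟩
  · rintro ⟨f, hf, k, rfl⟩
    obtain ⟨l, hl⟩ := exists_nat_mul_eq n k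
    exact ⟨f, hf, l, by rw [hl]⟩

theorem isPeriodic_rotationOrbit (S : Set (Edge (ZMod (4 * n)))) :
    IsPeriodic (4 * n) n (rotationOrbit (4 * n) n S) := by
  rw [isPeriodic_iff]
  intro e he k
  rw [mem_rotationOrbit] at he ⊢
  obtain ⟨f, hf, l, rfl⟩ := he
  refine ⟨f, hf, l + k, ?_⟩
  rw [Edge.translate_translate]
  congr 1
  push_cast
  ring

theorem subset_rotationOrbit (S : Set (Edge (ZMod (4 * n)))) : S ⊆ rotationOrbit (4 * n) n S :=
  fun e he => ⟨e, he, 0, by simp [Edge.translate_zero]⟩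

theorem rotationOrbit_subset {S T : Set (Edge (ZMod (4 * n)))} (hT : IsPeriodic (4 * n) n T)
    (h : S ⊆ T) : rotationOrbit (4 * n) n S ⊆ T := by
  intro e he
  obtain ⟨f, hf, k, rfl⟩ := mem_rotationOrbit.1 he
  exact isPeriodic_iff.1 hT f (h hf) k

theorem rotationOrbit_mono {S T : Set (Edge (ZMod (4 * n)))} (h : S ⊆ T) :
    rotationOrbit (4 * n) n S ⊆ rotationOrbit (4 * n) n T :=
  rotationOrbit_subset (isPeriodic_rotationOrbit T) (h.trans (subset_rotationOrbit T))

theorem mem_rotationOrbit_singleton_symm {e f : Edge (ZMod (4 * n))}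
    (h : e ∈ rotationOrbit (4 * n) n {f}) : f ∈ rotationOrbit (4 * n) n {e} := by
  obtain ⟨_, rfl, k, rfl⟩ := mem_rotationOrbit.1 h
  refine mem_rotationOrbit.2 ⟨_, rfl, -k, ?_⟩
  rw [Edge.translate_translate]
  simp [Edge.translate_zero]

theorem toPolygon_image_proj (C : Set (Edge ℤ)) :
    toPolygon n (proj n '' C) = rotationOrbit (4 * n) n (reduceMod (4 * n) C) := by
  apply Set.Subset.antisymm
  · rintro e ⟨g, ⟨c, hc, hcg⟩, he⟩
    obtain ⟨k, rfl⟩ := proj_eq_iff.1 hcg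
    obtain ⟨i, j, -, hij⟩ := c.exists_lt
    rw [Edge.translate_val hij, Sym2.map_mk] at he
    have hne : (i : ZMod (4 * n)) ≠ j := by
      intro h
      refine e.2 ?_
      rw [he]
      simp [h]
    refine mem_rotationOrbit.2 ⟨Edge.mk _ _ hne, mem_reduceMod hc hij rfl, k, ?_⟩
    apply Subtype.ext
    rw [he, Edge.translate_val (e := Edge.mk _ _ hne) rfl]
    push_cast
    rfl
  · refine rotationOrbit_subset (isPeriodic_toPolygon _) ?_
    rintro e ⟨g, hg, he⟩
    exact ⟨g, ⟨g, hg, rfl⟩, he⟩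

theorem isCylinderCrossing_iff (hn : 0 < n) {E : Set (CylinderEdge n)}
    (hE : LengthLE n (2 * n) E) :
    IsCylinderCrossing n 3 E ↔
      ∃ C, IsCrossing 3 C ∧ toPolygon n E = rotationOrbit (4 * n) n C := by
  have : NeZero (4 * n) := ⟨by omega⟩
  constructor
  · rintro ⟨C, hC, rfl⟩
    exact ⟨_, hC.reduceMod hn fun e he => hE e ⟨e, he, rfl⟩, toPolygon_image_proj C⟩
  · rintro ⟨C, hC, hEC⟩
    obtain ⟨a, b, c, d, e, f, g₁, g₂, g₃, hab, hbc, hcd, hde, hef, hfa, rfl, h1, h2, h3⟩ :=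
      hC.exists_zmod_chain
    push_cast at hfa
    -- Each edge gets its own orbit as relation, so the lifted triple contains a rotated copy of
    -- each of the three edges and nothing else; injectivity of φ on short sets then identifies `E`.
    have hP (g : Edge (ZMod (4 * n))) :=
      polygonRel_of_isPeriodic (isPeriodic_rotationOrbit ({g} : Set (Edge (ZMod (4 * n)))))
    have hself (g : Edge (ZMod (4 * n))) : g ∈ rotationOrbit (4 * n) n {g} :=
      subset_rotationOrbit {g} rfl
    obtain ⟨a', d', b', e', c', f', had, had', hbe, hbe', hcf, hcf', p1, p2, p3, x1, x2, x3⟩ :=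
      (hP g₁).exists_interleave (hP g₂) (hP g₃) hab hbc hcd hde hef hfa ⟨g₁, hself _, h1⟩
        ⟨g₂, hself _, h2⟩ ⟨g₃, hself _, h3⟩
    have hlen : ∀ g ∈ ({Edge.mk a' d' had.ne, Edge.mk b' e' hbe.ne, Edge.mk c' f' hcf.ne} :
        Set (Edge ℤ)), g.length ≤ 2 * n := by
      rintro g (rfl | rfl | rfl)
      · exact length_le_of_val rfl had had'
      · exact length_le_of_val rfl hbe hbe'
      · exact length_le_of_val rfl hcf hcf'
    refine ⟨_, isCrossing_of_interleave had hbe hcf x1 x2 x3, ?_⟩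
    refine injOn_toPolygon hn (lengthLE_image_proj hlen) hE ?_
    rw [toPolygon_image_proj, hEC]
    apply Set.Subset.antisymm
    · refine rotationOrbit_subset (isPeriodic_rotationOrbit _) ?_
      rintro x ⟨g, (rfl | rfl | rfl), hx⟩
      · exact rotationOrbit_mono (by simp) (p1.mem hx)
      · exact rotationOrbit_mono (by simp) (p2.mem hx)
      · exact rotationOrbit_mono (by simp) (p3.mem hx)
    · refine rotationOrbit_subset (isPeriodic_rotationOrbit _) ?_
      rintro x (rfl | rfl | rfl)
      · obtain ⟨y, hy, hy'⟩ := p1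
        refine rotationOrbit_mono ?_ (mem_rotationOrbit_singleton_symm hy)
        rintro _ rfl
        exact mem_reduceMod (g := Edge.mk a' d' had.ne) (by simp) rfl hy'
      · obtain ⟨y, hy, hy'⟩ := p2
        refine rotationOrbit_mono ?_ (mem_rotationOrbit_singleton_symm hy)
        rintro _ rfl
        exact mem_reduceMod (g := Edge.mk b' e' hbe.ne) (by simp) rfl hy'
      · obtain ⟨y, hy, hy'⟩ := p3
        refine rotationOrbit_mono ?_ (mem_rotationOrbit_singleton_symm hy)
        rintro _ rfl
        exact mem_reduceMod (g := Edge.mk c' f' hcf.ne) (by simp) rfl hy'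

end RotationOrbit

/-! ### Triangulations -/

section Triangulations

/-- An edge of length greater than `2n` crosses two of its translates, which cross each other. -/
theorem lengthLE_of_crossingFree (hn : 0 < n) {E : Set (CylinderEdge n)}
    (h : CrossingFree 3 (lift n E)) : LengthLE n (2 * n) E := by
  intro g hg
  by_contra hlen
  obtain ⟨i, j, hij, hg'⟩ := g.exists_lt
  rw [Edge.length_eq hg'] at hlen
  have hJ : Joins (lift n E) i j := ⟨g, hg, hg'⟩
  refine h _ ?_ (isCrossing_of_interleave (a := i) (d := j) (b := i + 1 * n) (e := j + 1 * n)
    (c := i + 2 * n) (f := j + 2 * n) hij (by omega) (by omega) (Or.inl (by omega))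
    (Or.inl (by omega)) (Or.inl (by omega)))
  rintro x (rfl | rfl | rfl)
  · exact hJ.mem rfl
  · exact (hJ.shift_lift 1).mem rfl
  · exact (hJ.shift_lift 2).mem rfl

theorem orbitBlocked_of_maximal (hn : 0 < n) {T : Set (CylinderEdge n)}
    (hT : IsCylinderTriangulation n 2 T) {a d : ℤ} (had : a < d) (hda : d ≤ a + 2 * n)
    (h : ¬ Joins (toPolygon n T) (a : ZMod (4 * n)) (d : ZMod (4 * n))) :
    OrbitBlocked n (fun i j => Joins (toPolygon n T) (i : ZMod (4 * n)) (j : ZMod (4 * n)))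
      a d := by
  set g : Edge ℤ := Edge.mk a d had.ne
  have hTlen := lengthLE_of_crossingFree hn hT.1
  have hfree : ¬ CrossingFree 3 (lift n (insert (proj n g) T)) := by
    intro hfree
    have hmem : proj n g ∈ T := hT.2 hfree (Set.subset_insert _ _) (Set.mem_insert _ _)
    exact h (Joins.toPolygon hn had hda ⟨g, hmem, rfl⟩)
  unfold CrossingFree at hfree
  push Not at hfree
  obtain ⟨C, hCT, hC⟩ := hfree
  obtain ⟨x₁, x₂, x₃, x₄, x₅, x₆, g₁, g₂, g₃, h12, h23, h34, h45, h56, rfl, h1, h2, h3⟩ :=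
    hC.exists_int_chain
  have key {x : Edge ℤ} {i j : ℤ} (hx : x ∈ lift n (insert (proj n g) T)) (hij : i < j)
      (hxij : x.1 = s(i, j)) : InExtension n
        (fun i j => Joins (toPolygon n T) (i : ZMod (4 * n)) (j : ZMod (4 * n))) a d i j := by
    rcases hx with hx | hx
    · right
      obtain ⟨k, rfl⟩ := proj_eq_iff.1 hx.symm
      refine ⟨k, ?_⟩
      rw [Edge.translate_val (e := g) rfl, Sym2.eq_iff] at hxij
      omega
    · left
      have hle := le_of_length_le hxij (hTlen x hx)
      exact ⟨Joins.toPolygon hn hij hle ⟨x, hx, hxij⟩, hle⟩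
  exact ⟨x₁, x₂, x₃, x₄, x₅, x₆, h12, h23, h34, h45, h56, key (hCT (by simp)) (by omega) h1,
    key (hCT (by simp)) (by omega) h2, key (hCT (by simp)) (by omega) h3⟩

/-- An edge outside the image of `T` is crossed by two mutually crossing edges of that image, so no
larger crossing-free set, periodic or not, can contain it. -/
theorem isPolygonTriangulation_toPolygon (hn : 0 < n) {T : Set (CylinderEdge n)}
    (hT : IsCylinderTriangulation n 2 T) : IsPolygonTriangulation (4 * n) 2 (toPolygon n T) := by
  have : NeZero (4 * n) := ⟨by omega⟩
  have hfree := (crossingFree_lift_iff hn (lengthLE_of_crossingFree hn hT.1)).1 hT.1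
  refine ⟨hfree, fun S hS hTS x hx => ?_⟩
  obtain ⟨a, d, had, hda, hxad⟩ := x.exists_short hn
  by_contra hxT
  obtain ⟨b, c, e, f, hab, hbc, hcd, hde, hef, hfa, ⟨p, hp, hbe⟩, ⟨q, hq, hcf⟩⟩ :=
    blocked_of_orbitBlocked (polygonRel_of_isPeriodic (isPeriodic_toPolygon T))
      (by exact_mod_cast hn) (by
        rintro ⟨a, b, c, d, e, f, hab, hbc, hcd, hde, hef, hfa, ⟨p, hp, had⟩, ⟨q, hq, hbe⟩,
          ⟨r, hr, hcf⟩⟩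
        refine hfree {p, q, r} ?_ (isCrossing_of_zmod_chain hab hbc hcd hde hef
          (by push_cast; omega) had hbe hcf)
        rintro y (rfl | rfl | rfl) <;> assumption)
      (fun a d had hda h => orbitBlocked_of_maximal hn hT had hda h) (2 * n) a d had hda
      (by push_cast; omega) (fun h => hxT (h.mem hxad))
  refine hS {x, p, q} ?_ (isCrossing_of_zmod_chain hab hbc hcd hde hef
    (by push_cast; omega) hxad hbe hcf)
  rintro y (rfl | rfl | rfl)
  exacts [hx, hTS hp, hTS hq]

theorem bijOn_toPolygon_triangulation (hn : 0 < n) :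
    Set.BijOn (toPolygon n) {T | IsCylinderTriangulation n 2 T}
      {T | IsPolygonTriangulation (4 * n) 2 T ∧ IsPeriodic (4 * n) n T} := by
  refine ⟨fun T hT => ⟨isPolygonTriangulation_toPolygon hn hT, isPeriodic_toPolygon T⟩,
    (injOn_toPolygon hn).mono fun T hT => lengthLE_of_crossingFree hn hT.1, ?_⟩
  rintro S ⟨hS, hSper⟩
  obtain ⟨E, hE, rfl⟩ := (bijOn_toPolygon_lengthLE hn).surjOn hSper
  refine ⟨E, ⟨(crossingFree_lift_iff hn hE).2 hS.1, fun F hF hEF => ?_⟩, rfl⟩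
  -- A crossing-free competitor is automatically short, so it can be compared with `E` inside the
  -- polygon.
  have hFlen := lengthLE_of_crossingFree hn hF
  exact subset_of_toPolygon_subset hn hFlen hE
    (hS.2 ((crossingFree_lift_iff hn hFlen).1 hF) (toPolygon_mono hEF))

end Triangulations

end Cylinder

end HalfCylinder

open HalfCylinder in
theorem mainTheorem4 (n : ℕ) (hn : 0 < n) :
    -- `φ` is a bijection from 2-triangulations on `C_n` to `n`-periodic ones of the `4n`-gon
    Set.BijOn (toPolygon n)
      {T | IsCylinderTriangulation n 2 T}
      {T | IsPolygonTriangulation (4 * n) 2 T ∧ IsPeriodic (4 * n) n T} ∧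
    -- `φ` is a bijection from sets of edges of length at most `2n` to `n`-periodic sets of edges
    Set.BijOn (toPolygon n) {E | LengthLE n (2 * n) E} {S | IsPeriodic (4 * n) n S} ∧
    -- reduction modulo `4n` sends 3-crossings of lifted edges to 3-crossings
    (∀ C : Set (Edge ℤ), (∀ e ∈ C, e.length ≤ 2 * n) → IsCrossing 3 C →
      IsCrossing 3 (reduceMod (4 * n) C)) ∧
    -- `φ` and its inverse preserve 3-crossings
    (∀ E : Set (CylinderEdge n), LengthLE n (2 * n) E →
      (IsCylinderCrossing n 3 E ↔
        ∃ C, IsCrossing 3 C ∧ toPolygon n E = rotationOrbit (4 * n) n C)) ∧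
    -- hence `φ` preserves and reflects being 3-crossing-free
    (∀ E : Set (CylinderEdge n), LengthLE n (2 * n) E →
      (CrossingFree 3 (lift n E) ↔ CrossingFree 3 (toPolygon n E))) := by
  exact ⟨bijOn_toPolygon_triangulation hn, bijOn_toPolygon_lengthLE hn,
    fun _ hlen hC => hC.reduceMod hn hlen, fun _ hE => isCylinderCrossing_iff hn hE,
    fun _ hE => crossingFree_lift_iff hn hE⟩
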